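/- **Setting.** Let $\mathcal G$ be a DAG on $[n]=\{1,\dots,n\}$ with parent sets $\mathrm{Pa}(i)$, and let $Z=(Z_1,\dots,Z_n)$ have the pdf $p(z)=\prod_{i=1}^n p_i(z_i\mid z_{\mathrm{Pa}(i)})$ on $\mathbb R^n$, where each conditional pdf $p_i$ is strictly positive, continuously differentiable in all its variables, and genuinely depends on each of the variables $z_j$, $j\in \mathrm{Pa}(i)$. For each node $i$ let $q_i$ and $\tilde q_i$ be two strictly positive $C^1$ pdfs on $\mathbb R$ (hard interventional mechanisms). Let $I$ and $\tilde I$ be two unknown permutations of $[n]$. In the environment $\mathcal E^m$ (respectively $\tilde{\mathcal E}^m$), $m\in[n]$, the latent vector has the pdf obtained from $p$ by replacing the factor $p_\ell$ by $q_\ell(z_\ell)$ with $\ell=I^m$ (respectively by $\tilde q_\ell(z_\ell)$ with $\ell=\tilde I^m$); $\mathcal E^0$ is the observational environment, with pdf $p$. One observes the laws of $X=g(Z)$ in all these $2n+1$ environments, where $g:\mathbb R^n\to\mathbb R^d$ is an unknown $C^1$ diffeomorphism onto its image $\mathcal X$. The set $\mathcal X$ is known, and which environments intervene on the same node is not known.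 Two pdfs $r_1,r_2$ on $\mathbb R$ satisfy *interventional discrepancy* if $\frac{\partial}{\partial u}\frac{r_1(u)}{r_2(u)}\ne 0$ for all $u$ outside a Lebesgue null set. Assume that for every $i$ the pair $(q_i,\tilde q_i)$ and, for every value of $z_{\mathrm{Pa}(i)}$, the pairs $(p_i(\cdot\mid z_{\mathrm{Pa}(i)}),q_i)$ and $(p_i(\cdot\mid z_{\mathrm{Pa}(i)}),\tilde q_i)$ satisfy interventional discrepancy. **Procedure (GSCALE-I).** Let $\mathcal H$ be the set of $C^1$ maps $h:\mathcal X\to\mathbb R^n$ that have an inverse $h^{-1}:h(\mathcal X)\to\mathcal X$ which is $C^1$. For $h\in\mathcal H$ let $\hat Z=h(X)$, and let $s,s^m,\tilde s^m$ be the score functions (gradients of the log-pdfs) of $\hat Z$ in $\mathcal E^0,\mathcal E^m,\tilde{\mathcal E}^m$; their differences are read as the gradients of the differences of the log-pdfs. With expectations over the observational law (values in $[0,\infty]$), put $$[D_t(h)]_{i,m}=\mathbb E\big|[s^m(\hat Z)-\tilde s^m(\hat Z)]_i\big|,\quad [D(h)]_{i,m}=\mathbb E\big|[s(\hat Z)-s^m(\hat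 Z)]_i\big|,\quad [\tilde D(h)]_{i,m}=\mathbb E\big|[s(\hat Z)-\tilde s^m(\hat Z)]_i\big|.$$ Write $\mathbb 1\{A\}$ for the $0$-$1$ matrix of nonzero entries of $A$, and $\|A\|_0$ for their number. For a permutation $\pi$ of $[n]$, relabel $\tilde{\mathcal E}^m$ as $\tilde{\mathcal E}^{\pi_m}$ for all $m$, and consider $$\mathcal P_2:\quad \min_{h\in\mathcal H}\|D_t(h)\|_0\quad\text{s.t. } D_t(h)\text{ is diagonal},\ \ \mathbb 1\{D(h)\}=\mathbb 1\{\tilde D(h)\},\ \ \mathbb 1\{D(h)\}\odot\mathbb 1\{D(h)^\top\}=I_{n\times n}.$$ GSCALE-I searches over the permutations $\pi$ until $\mathcal P_2$ has a solution, selects any solution $h^*$, and returns $\hat Z=h^*(X)$ and the graph $\hat{\mathcal G}$ in which the parents of $i$ are the $j\ne i$ with $[D(h^*)]_{j,i}\neq0$. **Theorem.** Under these assumptions: 1. (Identifiability.) There are estimators $\hat{\mathcal G}$ and $\hat Z(\cdot)$, depending only on $\mathcal X$ and the observed laws, such that for every model as above $\hat{\mathcal G}$ is isomorphic to $\mathcal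 G$, and $\hat Z(X)=P_\pi\cdot(\phi_1(Z_1),\dots,\phi_n(Z_n))$ for all $Z\in\mathbb R^n$, for some permutation $\pi$ with permutation matrix $P_\pi$ and some $C^1$ diffeomorphisms $\phi_i$ of $\mathbb R$ onto $\mathbb R$. 2. (Feasibility.) For each permutation $\pi$, problem $\mathcal P_2$ is feasible if and only if the coupling $\pi$ is correct, that is, $I^{\pi_m}=\tilde I^m$ for all $m$; if it is correct, $\mathcal P_2$ has a solution. 3. (Achievability.) GSCALE-I always returns an output, and for every possible output $\hat{\mathcal G}$ is isomorphic to $\mathcal G$ and $h^*(X)=P_\pi\cdot(\phi_1(Z_1),\dots,\phi_n(Z_n))$ for all $Z\in\mathbb R^n$, for some permutation $\pi$ and some $C^1$ diffeomorphisms $\phi_i$ of $\mathbb R$ onto their images, which are all of $\mathbb R$ if $h^*(\mathcal X)=\mathbb R^n$. -/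

import Mathlib

open MeasureTheory

open scoped ENNReal

namespace CRL

noncomputable section

/-! Points of `ℝⁿ` are functions `Fin n → ℝ`; `volume` is Lebesgue measure, and no notion below
depends on the choice of a norm on `ℝⁿ`. -/

/-- A `C¹` diffeomorphism onto its image: a `C¹` map that is a homeomorphism onto its image and
whose derivative is injective everywhere. -/
def IsC1DiffeoOntoImage {E F : Type*} [NormedAddCommGroup E] [NormedSpace ℝ E]
    [NormedAddCommGroup F] [NormedSpace ℝ F] (f : E → F) : Prop :=
  ContDiff ℝ 1 f ∧ Topology.IsEmbedding f ∧ ∀ x, Function.Injective (fderiv ℝ f x)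

/-- A directed graph without directed cycles. -/
def IsDAG {V : Type*} (G : Digraph V) : Prop :=
  ∀ v, ¬ Relation.TransGen G.Adj v v

/-- A strictly positive, continuously differentiable pdf on the real line. -/
structure IsC1Pdf (q : ℝ → ℝ) : Prop where
  contDiff : ContDiff ℝ 1 q
  pos : ∀ u, 0 < q u
  lintegral_eq_one : ∫⁻ u, ENNReal.ofReal (q u) = 1

/-- Interventional discrepancy of two pdfs on the line: the derivative of `p / q` is nonzero off
a Lebesgue null set. -/
def InterventionalDiscrepancy (p q : ℝ → ℝ) : Prop :=
  ∀ᵐ u : ℝ, deriv (fun v => p v / q v) u ≠ 0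

/-- A latent causal model with `n` latent and `d` observed variables, a transform, and two hard
interventional mechanisms per node, applied in two families of `n` atomic environments. -/
structure Model (n d : ℕ) where
  /-- the latent graph; `G.Adj j i` says that `j` is a parent of `i` -/
  G : Digraph (Fin n)
  isDAG : IsDAG G
  /-- `p i z` is the conditional pdf of `z i` given the parents of `i`, as a function of the
  whole vector `z` -/
  p : Fin n → (Fin n → ℝ) → ℝ
  p_contDiff : ∀ i, ContDiff ℝ 1 (p i)
  p_pos : ∀ i z, 0 < p i z
  p_lintegral_eq_one : ∀ i z, ∫⁻ u, ENNReal.ofReal (p i (Function.update z i u)) = 1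
  /-- `p i` is a function of `z i` and of the parents of `i` only ... -/
  p_local : ∀ i z z', z i = z' i → (∀ j, G.Adj j i → z j = z' j) → p i z = p i z'
  /-- ... and it does vary with each of the parents -/
  p_parent : ∀ i j, G.Adj j i → ∃ z t, p i (Function.update z j t) ≠ p i z
  /-- the first hard interventional mechanism of each node -/
  q : Fin n → ℝ → ℝ
  q_pdf : ∀ i, IsC1Pdf (q i)
  /-- the second hard interventional mechanism of each node -/
  qt : Fin n → ℝ → ℝ
  qt_pdf : ∀ i, IsC1Pdf (qt i)
  /-- the node intervened on in the `m`-th environment of the first family -/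
  I : Equiv.Perm (Fin n)
  /-- the node intervened on in the `m`-th environment of the second family -/
  It : Equiv.Perm (Fin n)
  /-- the transform from latent to observed variables -/
  g : (Fin n → ℝ) → (Fin d → ℝ)
  g_diffeo : IsC1DiffeoOntoImage g

/-- What the learner is given: the set of values of `X` (the domain of the encoders) and the laws
of `X` in the observational environment and in the two families of environments. -/
structure ObservedData (n d : ℕ) where
  X : Set (Fin d → ℝ)
  P : Measure (Fin d → ℝ)
  Pint : Fin n → Measure (Fin d → ℝ)
  Ptint : Fin n → Measure (Fin d → ℝ)

namespace Model

variable {n d : ℕ} (M : Model n d)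

/-- The observational pdf of `Z`. -/
def pdf (z : Fin n → ℝ) : ℝ := ∏ i, M.p i z

/-- The pdf of `Z` after a hard intervention that gives node `l` the mechanism `r`. -/
def hardPdf (l : Fin n) (r : ℝ → ℝ) (z : Fin n → ℝ) : ℝ :=
  r (z l) * ∏ i ∈ Finset.univ.erase l, M.p i z

/-- The law of `X = g Z` when `Z` has pdf `f`. -/
def lawX (f : (Fin n → ℝ) → ℝ) : Measure (Fin d → ℝ) :=
  (volume.withDensity fun z => ENNReal.ofReal (f z)).map M.g

/-- The data that the model generates. -/
def data : ObservedData n d where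
  X := Set.range M.g
  P := M.lawX M.pdf
  Pint := fun m => M.lawX (M.hardPdf (M.I m) (M.q (M.I m)))
  Ptint := fun m => M.lawX (M.hardPdf (M.It m) (M.qt (M.It m)))

/-- Each pair in `{p_i, q_i, q̃_i}` satisfies interventional discrepancy; for the pairs with `p_i`,
at every value of the parents of `i`. -/
def Discrepancy : Prop :=
  ∀ i,
    (∀ z, InterventionalDiscrepancy (fun u => M.p i (Function.update z i u)) (M.q i)) ∧
    (∀ z, InterventionalDiscrepancy (fun u => M.p i (Function.update z i u)) (M.qt i)) ∧
    InterventionalDiscrepancy (M.q i) (M.qt i)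

/-- The coupling that pairs the `m`-th environment of the second family with the `π m`-th one of
the first family is correct: both intervene on the same node. -/
def CorrectCoupling (π : Equiv.Perm (Fin n)) : Prop :=
  ∀ m, M.I (π m) = M.It m

end Model

/-- The continuous version on `U` of the Lebesgue density of `μ`, if there is one. (For open `U` it
is unique on `U`, see `pdfOn_eqOn`.) -/
def pdfOn {n : ℕ} (U : Set (Fin n → ℝ)) (μ : Measure (Fin n → ℝ)) : (Fin n → ℝ) → ℝ :=
  open Classical in
  if H : ∃ f : (Fin n → ℝ) → ℝ, ContinuousOn f U ∧ (∀ z ∈ U, 0 ≤ f z) ∧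
      μ.restrict U = (volume.restrict U).withDensity (fun z => ENNReal.ofReal (f z))
  then H.choose else 0

theorem pdfOn_eqOn {n : ℕ} {U : Set (Fin n → ℝ)} (hU : IsOpen U) {μ : Measure (Fin n → ℝ)}
    {f : (Fin n → ℝ) → ℝ} (hf : ContinuousOn f U) (h0 : ∀ z ∈ U, 0 ≤ f z)
    (hμ : μ.restrict U = (volume.restrict U).withDensity (fun z => ENNReal.ofReal (f z))) :
    Set.EqOn (pdfOn U μ) f U := by
  have H : ∃ f : (Fin n → ℝ) → ℝ, ContinuousOn f U ∧ (∀ z ∈ U, 0 ≤ f z) ∧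
      μ.restrict U = (volume.restrict U).withDensity (fun z => ENNReal.ofReal (f z)) :=
    ⟨f, hf, h0, hμ⟩
  have e : pdfOn U μ = H.choose := by rw [pdfOn, dif_pos H]
  obtain ⟨kc, k0, kμ⟩ := H.choose_spec
  rw [e]
  refine Measure.eqOn_open_of_ae_eq (μ := volume) ?_ hU kc hf
  have ae := (withDensity_eq_iff_of_sigmaFinite
    (kc.aemeasurable hU.measurableSet).ennreal_ofReal
    (hf.aemeasurable hU.measurableSet).ennreal_ofReal).1 (kμ.symm.trans hμ)
  filter_upwards [ae, ae_restrict_mem hU.measurableSet] with z hz hzU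
  exact (ENNReal.ofReal_eq_ofReal_iff (k0 z hzU) (h0 z hzU)).1 hz

/-- The `i`-th coordinate at `z` of the score function, i.e. of the gradient of the logarithm of
the pdf, of a law `μ` on `U ⊆ ℝⁿ`. -/
def score {n : ℕ} (U : Set (Fin n → ℝ)) (μ : Measure (Fin n → ℝ)) (z : Fin n → ℝ) (i : Fin n) :
    ℝ :=
  fderiv ℝ (fun w => Real.log (pdfOn U μ w)) z (Pi.single i 1)

/-- The `i`-th coordinate at `z` of the difference of the score functions of `μ` and `ν`, namely of
the gradient of `log p_μ - log p_ν`. It agrees with the difference of the two scores where both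
exist (`scoreDiff_eq`), and it also makes sense for the laws of a `C¹` transform of a random vector,
whose pdfs are only continuous because of the Jacobian factor that they have in common. -/
def scoreDiff {n : ℕ} (U : Set (Fin n → ℝ)) (μ ν : Measure (Fin n → ℝ)) (z : Fin n → ℝ)
    (i : Fin n) : ℝ :=
  fderiv ℝ (fun w => Real.log (pdfOn U μ w) - Real.log (pdfOn U ν w)) z (Pi.single i 1)

theorem scoreDiff_eq {n : ℕ} (U : Set (Fin n → ℝ)) (μ ν : Measure (Fin n → ℝ)) (z : Fin n → ℝ)
    (i : Fin n) (hμ : DifferentiableAt ℝ (fun w => Real.log (pdfOn U μ w)) z)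
    (hν : DifferentiableAt ℝ (fun w => Real.log (pdfOn U ν w)) z) :
    scoreDiff U μ ν z i = score U μ z i - score U ν z i := by
  simp [scoreDiff, score, fderiv_fun_sub hμ hν]

/-- The valid encoders: the `C¹` maps `h` from `X` to `ℝⁿ` that have a decoder, `C¹` on `h(X)`.
Only the values of `h` on `X` matter. -/
def ValidEncoder {n d : ℕ} (X : Set (Fin d → ℝ)) (h : (Fin d → ℝ) → (Fin n → ℝ)) : Prop :=
  ContDiffOn ℝ 1 h X ∧
    ∃ k : (Fin n → ℝ) → (Fin d → ℝ), ContDiffOn ℝ 1 k (h '' X) ∧ ∀ x ∈ X, k (h x) = x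

namespace ObservedData

variable {n d : ℕ} (D : ObservedData n d)

/-- Score change matrix of the estimate `h X` between the environments `μ m` and `ν m`; the
expectation is over the observational law. The entries may be infinite. -/
def scoreChange (μ ν : Fin n → Measure (Fin d → ℝ)) (h : (Fin d → ℝ) → (Fin n → ℝ)) :
    Matrix (Fin n) (Fin n) ℝ≥0∞ :=
  Matrix.of fun i m =>
    ∫⁻ z, ‖scoreDiff (h '' D.X) ((μ m).map h) ((ν m).map h) z i‖ₑ ∂(D.P.map h)

/-- The matrix `D_t(h)`: first against second family. -/
def matDt (h : (Fin d → ℝ) → (Fin n → ℝ)) : Matrix (Fin n) (Fin n) ℝ≥0∞ :=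
  D.scoreChange D.Pint D.Ptint h

/-- The matrix `D(h)`: observational environment against first family. -/
def matD (h : (Fin d → ℝ) → (Fin n → ℝ)) : Matrix (Fin n) (Fin n) ℝ≥0∞ :=
  D.scoreChange (fun _ => D.P) D.Pint h

/-- The matrix `D̃(h)`: observational environment against second family. -/
def matDtilde (h : (Fin d → ℝ) → (Fin n → ℝ)) : Matrix (Fin n) (Fin n) ℝ≥0∞ :=
  D.scoreChange (fun _ => D.P) D.Ptint h

/-- Relabel the `m`-th environment of the second family as the `π m`-th, for all `m`. -/
def relabel (π : Equiv.Perm (Fin n)) : ObservedData n d :=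
  { D with Ptint := fun m => D.Ptint (π.symm m) }

end ObservedData

open Classical in
/-- The `0`-`1` matrix of the nonzero entries of `A`. -/
def indic {n : ℕ} (A : Matrix (Fin n) (Fin n) ℝ≥0∞) : Matrix (Fin n) (Fin n) ℕ :=
  Matrix.of fun i j => if A i j ≠ 0 then 1 else 0

/-- The number of nonzero entries of `A`. -/
def l0norm {n : ℕ} (A : Matrix (Fin n) (Fin n) ℝ≥0∞) : ℕ :=
  Set.ncard {ij : Fin n × Fin n | A ij.1 ij.2 ≠ 0}

/-- `h` satisfies the constraints of the optimization problem `P₂` posed by the data `D`. -/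
structure P2Feasible {n d : ℕ} (D : ObservedData n d) (h : (Fin d → ℝ) → (Fin n → ℝ)) : Prop where
  valid : ValidEncoder D.X h
  diag : (D.matDt h).IsDiag
  same : indic (D.matD h) = indic (D.matDtilde h)
  no_two_cycle : Matrix.hadamard (indic (D.matD h)) (indic (D.matD h).transpose) = 1

/-- `h` solves `P₂`: it is feasible and minimizes `‖D_t(h)‖₀` among the feasible encoders. -/
def P2Solution {n d : ℕ} (D : ObservedData n d) (h : (Fin d → ℝ) → (Fin n → ℝ)) : Prop :=
  P2Feasible D h ∧ ∀ h', P2Feasible D h' → l0norm (D.matDt h) ≤ l0norm (D.matDt h')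

/-- The graph read off from `D(h)`: the parents of `i` are the `j ≠ i` with `[D(h)]_{j,i} ≠ 0`. -/
def graphOf {n d : ℕ} (D : ObservedData n d) (h : (Fin d → ℝ) → (Fin n → ℝ)) : Digraph (Fin n) where
  Adj := fun j i => j ≠ i ∧ D.matD h j i ≠ 0

/-- `(h, Gh)` is a possible output of GSCALE-I (uncoupled mode) on the data `D`: search the
couplings `π` for one whose problem `P₂` has a solution, select a solution `h`, and read off the
graph. All orders of the search and all selections are allowed. -/
def GSCALEI {n d : ℕ} (D : ObservedData n d) (h : (Fin d → ℝ) → (Fin n → ℝ))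
    (Gh : Digraph (Fin n)) : Prop :=
  (∃ π : Equiv.Perm (Fin n), P2Solution (D.relabel π) h) ∧ Gh = graphOf D h

/-- Perfect DAG recovery: the two graphs are isomorphic. -/
def PerfectDAGRecovery {n : ℕ} (G Gh : Digraph (Fin n)) : Prop :=
  Nonempty (G.Adj ≃r Gh.Adj)

/-- Perfect latent recovery by an estimate, given as a function `Zh` of the true latent vector: it
is `P_π (φ_1(z_1), …, φ_n(z_n))` for a permutation `π` and `C¹` diffeomorphisms `φ_i` of the line
onto their images, which are the whole line if the estimate takes all values in `ℝⁿ`. -/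
def PerfectLatentRecovery {n : ℕ} (Zh : (Fin n → ℝ) → (Fin n → ℝ)) : Prop :=
  ∃ (π : Equiv.Perm (Fin n)) (φ : Fin n → ℝ → ℝ),
    (∀ i, IsC1DiffeoOntoImage (φ i)) ∧
    (Function.Surjective Zh → ∀ i, Function.Surjective (φ i)) ∧
    ∀ z i, Zh z i = φ (π i) (z (π i))

end

end CRL

/-! Put `f = h ∘ g`, a `C¹` diffeomorphism of `ℝⁿ` onto an open set, and let its frame at `z`
consist of the vectors that `Df z` sends to the standard basis. The Jacobian factor is common to all
environments and cancels, so the `i`-th coordinate of a score difference at `f z` is the derivative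
of a latent log-ratio along the `i`-th frame vector (`scoreDiff_map`). By continuity and positivity,
an entry of a score change matrix is nonzero iff this derivative is nonzero somewhere.

For a node `l` coupled correctly at label `m`, the log-ratio behind column `m` of `D_t` depends on
`z l` alone. By discrepancy its derivative is nonzero on a dense set, so diagonality of `D_t` forces
every frame vector except the `m`-th to have zero `l`-component (`frame_apply_eq_zero`).

A feasible coupling is correct by induction along the DAG (`correctCoupling_of_feasible`). Suppose
that node `t` is hit at label `m` in one family and `k` in the other, while its parents are coupled
correctly. Then the frame vectors `m` and `k` do not move the parents, so columns `m` of `D` and `k`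
of `D̃` have the same zero pattern in rows `m` and `k`. As `D` and `D̃` share their pattern and a
nonzero diagonal, `D` has a two-cycle unless `m = k`.

Under a correct coupling the `m`-th frame vector is therefore a multiple of the axis `I m`. Hence
`f` acts coordinatewise, and `D` records which partial derivatives of the mechanisms are not
identically zero, which is the graph. This uses feasibility alone. Conversely, inverting `g` and
permuting coordinates by `I` is feasible (`feasible_trueEncoder`), and a minimum of natural numbers
is attained. -/

namespace CRL

/-! ### Diffeomorphisms onto open or embedded images -/

section Diffeo

variable {E F : Type*} [NormedAddCommGroup E] [NormedSpace ℝ E] [NormedAddCommGroup F]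
  [NormedSpace ℝ F]

/-- An injective `C¹` map whose derivative is invertible everywhere. -/
structure IsC1OpenEmbedding (f : E → F) : Prop where
  contDiff : ContDiff ℝ 1 f
  injective : Function.Injective f
  invertible : ∀ z, (fderiv ℝ f z).IsInvertible

theorem IsC1OpenEmbedding.hasFDerivAt {f : E → F} (hf : IsC1OpenEmbedding f) (z : E) :
    HasFDerivAt f (fderiv ℝ f z) z :=
  (hf.contDiff.differentiable one_ne_zero z).hasFDerivAt

theorem IsC1OpenEmbedding.isOpenEmbedding [CompleteSpace E] {f : E → F}
    (hf : IsC1OpenEmbedding f) : Topology.IsOpenEmbedding f := by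
  refine .of_continuous_injective_isOpenMap hf.contDiff.continuous hf.injective
    (isOpenMap_iff_nhds_le.2 fun z => ?_)
  obtain ⟨e, he⟩ := hf.invertible z
  have h : HasStrictFDerivAt f (e : E →L[ℝ] F) z := by
    rw [he]; exact hf.contDiff.contDiffAt.hasStrictFDerivAt one_ne_zero
  exact h.map_nhds_eq_of_equiv.ge

theorem IsC1OpenEmbedding.hasFDerivAt_invFun [CompleteSpace E] {f : E → F}
    (hf : IsC1OpenEmbedding f) (z : E) :
    HasFDerivAt (Function.invFun f) (fderiv ℝ f z).inverse (f z) := by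
  have hl : Function.LeftInverse (Function.invFun f) f := Function.leftInverse_invFun hf.injective
  have ho := hf.isOpenEmbedding
  obtain ⟨e, he⟩ := hf.invertible z
  rw [← he, ContinuousLinearMap.inverse_equiv]
  refine HasFDerivAt.of_local_left_inverse (f := f) ?_ ?_ ?_
  · rw [← ho.continuousAt_iff, hl.comp_eq_id]
    exact continuousAt_id
  · rw [hl z, he]; exact hf.hasFDerivAt z
  · filter_upwards [ho.isOpen_range.mem_nhds ⟨z, rfl⟩]
    rintro _ ⟨y, rfl⟩
    rw [hl y]

theorem IsC1OpenEmbedding.isC1DiffeoOntoImage [CompleteSpace E] {f : E → F}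
    (hf : IsC1OpenEmbedding f) : IsC1DiffeoOntoImage f :=
  ⟨hf.contDiff, hf.isOpenEmbedding.isEmbedding, fun z => (hf.invertible z).injective⟩

/-- Injectivity is Rolle's theorem. -/
theorem isC1OpenEmbedding_of_deriv_ne_zero {φ : ℝ → ℝ} (hφ : ContDiff ℝ 1 φ)
    (h : ∀ u, deriv φ u ≠ 0) : IsC1OpenEmbedding φ := by
  refine ⟨hφ, ?_, fun z => ?_⟩
  · have key : ∀ a b, a < b → φ a ≠ φ b := fun a b hab he => by
      obtain ⟨c, -, hc⟩ := exists_deriv_eq_zero hab hφ.continuous.continuousOn he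
      exact h c hc
    intro a b hab
    by_contra hne
    rcases lt_or_gt_of_ne hne with hlt | hlt
    · exact key a b hlt hab
    · exact key b a hlt hab.symm
  · refine ⟨ContinuousLinearEquiv.unitsEquivAut ℝ (Units.mk0 _ (h z)), ?_⟩
    ext
    simp

/-- The inverse of a `C¹` diffeomorphism onto its image is `C¹` on the image. -/
theorem IsC1DiffeoOntoImage.contDiffOn_invFun [FiniteDimensional ℝ E] [FiniteDimensional ℝ F]
    {g : E → F} (hg : IsC1DiffeoOntoImage g) :
    ContDiffOn ℝ 1 (Function.invFun g) (Set.range g) := by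
  have : CompleteSpace E := FiniteDimensional.complete ℝ E
  have hl : Function.LeftInverse (Function.invFun g) g :=
    Function.leftInverse_invFun hg.2.1.injective
  rintro _ ⟨z, rfl⟩
  -- With `L` a linear left inverse of `Dg z`, the map `L ∘ g` has derivative the identity at `z`.
  -- On the image near `g z`, the inverse of `g` is `L` followed by the local inverse of `L ∘ g`.
  obtain ⟨L₀, hL₀⟩ := (fderiv ℝ g z).toLinearMap.exists_leftInverse_of_injective
    (LinearMap.ker_eq_bot.2 (hg.2.2 z))
  let L : F →L[ℝ] E := LinearMap.toContinuousLinearMap L₀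
  have hL : ∀ v, L (fderiv ℝ g z v) = v := fun v => LinearMap.congr_fun hL₀ v
  have hLg : ContDiffAt ℝ 1 (fun y => L (g y)) z := (L.contDiff.comp hg.1).contDiffAt
  have hd : HasFDerivAt (fun y => L (g y)) ((ContinuousLinearEquiv.refl ℝ E : E ≃L[ℝ] E) : E →L[ℝ] E)
      z := by
    refine (L.hasFDerivAt.comp z (hg.1.differentiable one_ne_zero z).hasFDerivAt).congr_fderiv ?_
    ext v
    simp [hL]
  have hinv := (hLg.to_localInverse hd one_ne_zero).comp (g z) L.contDiff.contDiffAt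
  refine hinv.contDiffWithinAt.congr_of_eventuallyEq ?_ ?_
  · have hev : ∀ᶠ y in nhds z, hLg.localInverse hd one_ne_zero (L (g y)) = y :=
      hLg.hasStrictFDerivAt' hd one_ne_zero |>.eventually_left_inverse
    -- Here `g` must be an embedding: neighbourhoods of `g z` in the image come from neighbourhoods
    -- of `z`.
    rw [Filter.EventuallyEq, ← hg.2.1.map_nhds_eq, Filter.eventually_map]
    filter_upwards [hev] with y hy
    rw [hl y]
    exact hy.symm
  · rw [hl z]
    exact ((hLg.hasStrictFDerivAt' hd one_ne_zero).localInverse_apply_image).symm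

/-- The chain rule for `k ∘ (h ∘ g) = g` makes the derivative of `h ∘ g` injective, hence invertible
since it is an endomorphism in finite dimension. The image of `h ∘ g` is not yet known to be open,
so `k` is differentiated only within it. -/
theorem isC1OpenEmbedding_comp_of_leftInverse [FiniteDimensional ℝ E] {g : E → F}
    (hg : IsC1DiffeoOntoImage g) {h : F → E} {k : E → F} (hh : ContDiffOn ℝ 1 h (Set.range g))
    (hk : ContDiffOn ℝ 1 k (h '' Set.range g)) (hkh : ∀ x ∈ Set.range g, k (h x) = x) :
    IsC1OpenEmbedding (h ∘ g) := by
  have hc : ContDiff ℝ 1 (h ∘ g) := by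
    rw [← contDiffOn_univ]
    exact hh.comp hg.1.contDiffOn fun z _ => ⟨z, rfl⟩
  refine ⟨hc, fun a b hab => hg.2.1.injective ?_, fun z => ?_⟩
  · rw [← hkh _ ⟨a, rfl⟩, ← hkh _ ⟨b, rfl⟩]
    exact congrArg k hab
  · have h1 : HasFDerivAt (h ∘ g) (fderiv ℝ (h ∘ g) z) z :=
      (hc.differentiable one_ne_zero z).hasFDerivAt
    set k' := fderivWithin ℝ k (h '' Set.range g) (h (g z))
    have h2 : HasFDerivWithinAt k k' (h '' Set.range g) ((h ∘ g) z) := (hk.differentiableOn one_ne_zero (h (g z)) ⟨g z, ⟨z, rfl⟩, rfl⟩).hasFDerivWithinAt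
    have h3 : HasFDerivAt (k ∘ (h ∘ g)) (k'.comp (fderiv ℝ (h ∘ g) z)) z := by
      rw [← hasFDerivWithinAt_univ] at h1 ⊢
      exact HasFDerivWithinAt.comp z h2 h1 fun y _ => ⟨g y, ⟨y, rfl⟩, rfl⟩
    have h4 : k ∘ (h ∘ g) = g := funext fun y => hkh _ ⟨y, rfl⟩
    rw [h4] at h3
    have hinj : Function.Injective (fderiv ℝ (h ∘ g) z) := fun a b hab => hg.2.2 z (by
      simp only [h3.fderiv, ContinuousLinearMap.comp_apply, hab])
    let e := LinearEquiv.ofInjectiveEndo (fderiv ℝ (h ∘ g) z).toLinearMap hinj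
    exact ⟨e.toContinuousLinearEquiv, by ext v; rfl⟩

end Diffeo

theorem ValidEncoder.isC1OpenEmbedding {n d : ℕ} {g : (Fin n → ℝ) → (Fin d → ℝ)}
    (hg : IsC1DiffeoOntoImage g) {h : (Fin d → ℝ) → (Fin n → ℝ)}
    (hh : ValidEncoder (Set.range g) h) : IsC1OpenEmbedding (h ∘ g) := by
  obtain ⟨hc, k, hk, hkh⟩ := hh
  exact isC1OpenEmbedding_comp_of_leftInverse hg hc hk hkh

/-! ### Score differences of a transformed vector in terms of the frame -/

section Frame

variable {n : ℕ}

/-- The vectors that `Df z` maps to the standard basis, i.e. the columns at `f z` of the Jacobian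
of the inverse of `f`. -/
noncomputable def frame (f : (Fin n → ℝ) → (Fin n → ℝ)) (i : Fin n) (z : Fin n → ℝ) : Fin n → ℝ :=
  (fderiv ℝ f z).inverse (Pi.single i 1)

theorem IsC1OpenEmbedding.continuous_frame {f : (Fin n → ℝ) → (Fin n → ℝ)}
    (hf : IsC1OpenEmbedding f) (i : Fin n) : Continuous (frame f i) := by
  refine continuous_iff_continuousAt.2 fun z => ?_
  have h1 : ContinuousAt (fun y => (fderiv ℝ f y).inverse) z :=
    ContinuousAt.comp (f := fderiv ℝ f)
      ((hf.invertible z).contDiffAt_map_inverse (n := 0)).continuousAt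
      (hf.contDiff.continuous_fderiv one_ne_zero).continuousAt
  exact h1.clm_apply continuousAt_const

theorem IsC1OpenEmbedding.sum_frame {f : (Fin n → ℝ) → (Fin n → ℝ)}
    (hf : IsC1OpenEmbedding f) (z v : Fin n → ℝ) :
    ∑ i, fderiv ℝ f z v i • frame f i z = v := by
  have h := (hf.invertible z).inverse_apply_self v
  conv_rhs => rw [← h, pi_eq_sum_univ' (fderiv ℝ f z v)]
  rw [map_sum]
  refine Finset.sum_congr rfl fun i _ => ?_
  rw [frame, ← map_smul]

theorem IsC1OpenEmbedding.det_ne_zero {f : (Fin n → ℝ) → (Fin n → ℝ)}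
    (hf : IsC1OpenEmbedding f) (z : Fin n → ℝ) : (fderiv ℝ f z).det ≠ 0 := by
  obtain ⟨e, he⟩ := hf.invertible z
  rw [← he]
  exact e.toLinearEquiv.isUnit_det'.ne_zero

/-- The pdf of `f Z` when `Z` has a positive continuous pdf `r`. -/
theorem pdfOn_map {f : (Fin n → ℝ) → (Fin n → ℝ)} (hf : IsC1OpenEmbedding f)
    {r : (Fin n → ℝ) → ℝ} (hr : Continuous r) (hpos : ∀ z, 0 < r z) (z : Fin n → ℝ) :
    pdfOn (Set.range f) ((volume.withDensity fun z => ENNReal.ofReal (r z)).map f) (f z) =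
      r z / |(fderiv ℝ f z).det| := by
  have hl : Function.LeftInverse (Function.invFun f) f := Function.leftInverse_invFun hf.injective
  have ho := hf.isOpenEmbedding
  set k : (Fin n → ℝ) → ℝ := fun w =>
    r (Function.invFun f w) / |(fderiv ℝ f (Function.invFun f w)).det| with hk
  have hkf : ∀ y, k (f y) = r y / |(fderiv ℝ f y).det| := fun y => by simp only [hk, hl y]
  have hdet : Continuous fun y => |(fderiv ℝ f y).det| :=
    (ContinuousLinearMap.continuous_det.comp (hf.contDiff.continuous_fderiv one_ne_zero)).abs
  have hdpos : ∀ y, 0 < |(fderiv ℝ f y).det| := fun y => abs_pos.2 (hf.det_ne_zero y)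
  rw [← hkf z]
  refine pdfOn_eqOn ho.isOpen_range ?_ ?_ ?_ ⟨z, rfl⟩
  · rintro _ ⟨y, rfl⟩
    refine ContinuousAt.continuousWithinAt (ho.continuousAt_iff.1 ?_)
    have : k ∘ f = fun y => r y / |(fderiv ℝ f y).det| := funext hkf
    rw [this]
    exact (hr.div hdet fun y => (hdpos y).ne').continuousAt
  · rintro _ ⟨y, rfl⟩
    rw [hkf]
    exact div_nonneg (hpos y).le (hdpos y).le
  · ext A hA
    have hme : Measurable f := hf.contDiff.continuous.measurable
    have hU := ho.isOpen_range.measurableSet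
    rw [Measure.restrict_apply hA, Measure.map_apply hme (hA.inter hU),
      withDensity_apply _ (hme (hA.inter hU)), withDensity_apply _ hA,
      Measure.restrict_restrict hA]
    have e1 : f ⁻¹' (A ∩ Set.range f) = f ⁻¹' A := by ext; simp
    have e2 : A ∩ Set.range f = f '' (f ⁻¹' A) := (Set.image_preimage_eq_inter_range).symm
    -- Change of variables; the determinant cancels the denominator of the claimed density.
    rw [e1, e2, lintegral_image_eq_lintegral_abs_det_fderiv_mul volume (hme hA)
      (fun y _ => (hf.hasFDerivAt y).hasFDerivWithinAt) hf.injective.injOn]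
    refine lintegral_congr fun y => ?_
    rw [hkf, ← ENNReal.ofReal_mul (hdpos y).le, mul_div_cancel₀ _ (hdpos y).ne']

/-- The log-determinant, which is merely continuous, cancels before differentiation. What remains is
the latent log-ratio composed with the inverse of `f`, to which the chain rule applies. -/
theorem scoreDiff_map {f : (Fin n → ℝ) → (Fin n → ℝ)} (hf : IsC1OpenEmbedding f)
    {r s : (Fin n → ℝ) → ℝ} (hr : ContDiff ℝ 1 r) (hrpos : ∀ z, 0 < r z) (hs : ContDiff ℝ 1 s)
    (hspos : ∀ z, 0 < s z) (z : Fin n → ℝ) (i : Fin n) :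
    scoreDiff (Set.range f) ((volume.withDensity fun z => ENNReal.ofReal (r z)).map f)
      ((volume.withDensity fun z => ENNReal.ofReal (s z)).map f) (f z) i =
      fderiv ℝ (fun y => Real.log (r y) - Real.log (s y)) z (frame f i z) := by
  have hl : Function.LeftInverse (Function.invFun f) f := Function.leftInverse_invFun hf.injective
  set ρ : (Fin n → ℝ) → ℝ := fun y => Real.log (r y) - Real.log (s y) with hρ
  have hρd : HasFDerivAt ρ (fderiv ℝ ρ z) (Function.invFun f (f z)) := by
    rw [hl z]
    exact (((hr.log fun y => (hrpos y).ne').sub (hs.log fun y => (hspos y).ne')).differentiable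
      one_ne_zero z).hasFDerivAt
  have hcomp := hρd.comp (f z) (hf.hasFDerivAt_invFun z)
  rw [scoreDiff, Filter.EventuallyEq.fderiv_eq (f := ρ ∘ Function.invFun f), hcomp.fderiv]
  · rfl
  · filter_upwards [hf.isOpenEmbedding.isOpen_range.mem_nhds ⟨z, rfl⟩]
    rintro _ ⟨y, rfl⟩
    have hdpos : 0 < |(fderiv ℝ f y).det| := abs_pos.2 (hf.det_ne_zero y)
    rw [pdfOn_map hf hr.continuous hrpos, pdfOn_map hf hs.continuous hspos, Function.comp_apply,
      hl y, Real.log_div (hrpos y).ne' hdpos.ne', Real.log_div (hspos y).ne' hdpos.ne', hρ]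
    ring

/-- A mean absolute score difference of `f Z` is nonzero as soon as the integrand is nonzero
somewhere. -/
theorem lintegral_scoreDiff_map_ne_zero_iff {f : (Fin n → ℝ) → (Fin n → ℝ)}
    (hf : IsC1OpenEmbedding f) {p r s : (Fin n → ℝ) → ℝ} (hp : Continuous p)
    (hppos : ∀ z, 0 < p z) (hr : ContDiff ℝ 1 r) (hrpos : ∀ z, 0 < r z) (hs : ContDiff ℝ 1 s)
    (hspos : ∀ z, 0 < s z) (i : Fin n) :
    ∫⁻ w, ‖scoreDiff (Set.range f) ((volume.withDensity fun z => ENNReal.ofReal (r z)).map f)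
      ((volume.withDensity fun z => ENNReal.ofReal (s z)).map f) w i‖ₑ
        ∂((volume.withDensity fun z => ENNReal.ofReal (p z)).map f) ≠ 0 ↔
      ∃ z, fderiv ℝ (fun y => Real.log (r y) - Real.log (s y)) z (frame f i z) ≠ 0 := by
  have hmeas : Measurable fun w => ‖scoreDiff (Set.range f)
      ((volume.withDensity fun z => ENNReal.ofReal (r z)).map f)
      ((volume.withDensity fun z => ENNReal.ofReal (s z)).map f) w i‖ₑ :=
    (measurable_fderiv_apply_const ℝ _ _).enorm
  have hρ : ContDiff ℝ 1 fun y => Real.log (r y) - Real.log (s y) :=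
    (hr.log fun y => (hrpos y).ne').sub (hs.log fun y => (hspos y).ne')
  have hcont : Continuous fun z =>
      fderiv ℝ (fun y => Real.log (r y) - Real.log (s y)) z (frame f i z) :=
    (hρ.continuous_fderiv one_ne_zero).clm_apply (hf.continuous_frame i)
  have hpm : Measurable fun z => ENNReal.ofReal (p z) := hp.measurable.ennreal_ofReal
  have hfm : Measurable f := hf.contDiff.continuous.measurable
  rw [not_iff_comm, not_exists, lintegral_map hmeas hfm,
    lintegral_eq_zero_iff (by exact hmeas.comp hfm)]
  simp only [scoreDiff_map hf hr hrpos hs hspos, not_not]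
  -- Since `p > 0`, null sets of the observational law are Lebesgue null, and a continuous function
  -- that vanishes Lebesgue almost everywhere is zero.
  rw [Filter.EventuallyEq, ae_withDensity_iff hpm]
  simp only [Pi.zero_apply, enorm_eq_zero, ne_eq, ENNReal.ofReal_eq_zero, not_le, hppos,
    forall_const]
  rw [← funext_iff (g := fun _ => (0 : ℝ)), ← Continuous.ae_eq_iff_eq volume hcont continuous_const]
  rfl

end Frame

/-! ### Directional derivatives and dense nonvanishing -/

section Calculus

theorem fderiv_apply_eq_zero_of_forall_add_smul {E : Type*} [NormedAddCommGroup E]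
    [NormedSpace ℝ E] {ρ : E → ℝ} {z w : E} (hρ : DifferentiableAt ℝ ρ z)
    (h : ∀ t : ℝ, ρ (z + t • w) = ρ z) : fderiv ℝ ρ z w = 0 := by
  rw [← hρ.lineDeriv_eq_fderiv, lineDeriv]
  simp [h]

theorem eq_of_fderiv_sub_eq_zero {E : Type*} [NormedAddCommGroup E] [NormedSpace ℝ E] {ρ : E → ℝ}
    (hρ : Differentiable ℝ ρ) (z z' : E) (h : ∀ y, fderiv ℝ ρ y (z' - z) = 0) : ρ z' = ρ z := by
  have hd : ∀ t : ℝ, HasDerivAt (fun t : ℝ => ρ (z + t • (z' - z))) 0 t := fun t => by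
    have h1 : HasDerivAt (fun t : ℝ => z + t • (z' - z)) (z' - z) t := by
      simpa using ((hasDerivAt_id t).smul_const (z' - z)).const_add z
    have h2 := (hρ (z + t • (z' - z))).hasFDerivAt.comp_hasDerivAt t h1
    rwa [h] at h2
  have := is_const_of_deriv_eq_zero (fun t => (hd t).differentiableAt) (fun t => (hd t).deriv) 1 0
  simpa using this

theorem exists_ne_zero_and_of_dense {X : Type*} [TopologicalSpace X] {a : X → ℝ}
    (ha : Continuous a) {P : X → Prop} (hP : Dense {x | P x}) (h : ∃ x, a x ≠ 0) :
    ∃ x, a x ≠ 0 ∧ P x := by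
  obtain ⟨x, hx, hPx⟩ := hP.inter_open_nonempty _ (isOpen_ne_fun ha continuous_const) h
  exact ⟨x, hx, hPx⟩

/-- A conull subset of the line through `z` parallel to axis `l` is dense in it, so it accumulates
at `z`. -/
theorem dense_of_forall_ae_update {n : ℕ} (l : Fin n) {P : (Fin n → ℝ) → Prop}
    (h : ∀ z, ∀ᵐ u : ℝ, P (Function.update z l u)) : Dense {z | P z} := fun z => by
  have hd := (Measure.dense_of_ae (h z)) (z l)
  have hc : Continuous fun u : ℝ => Function.update z l u := continuous_const.update l continuous_id
  have hz : Function.update z l (z l) ∈ closure {z | P z} :=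
    map_mem_closure hc hd fun u hu => hu
  rwa [Function.update_eq_self] at hz

theorem fderiv_comp_apply {n : ℕ} {φ : ℝ → ℝ} (hφ : Differentiable ℝ φ) (l : Fin n)
    (z v : Fin n → ℝ) : fderiv ℝ (fun y : Fin n → ℝ => φ (y l)) z v = deriv φ (z l) * v l := by
  have h := (hφ (z l)).hasDerivAt.comp_hasFDerivAt z
    (hasFDerivAt_apply (𝕜 := ℝ) (F' := fun _ : Fin n => ℝ) l z)
  rw [show (fun y : Fin n → ℝ => φ (y l)) = φ ∘ (fun y => y l) from rfl, h.fderiv]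
  simp

/-- The ratio is the exponential of the log-ratio, so a critical point of the latter is one of the
former. -/
theorem InterventionalDiscrepancy.ae_deriv_log_ne_zero {p q : ℝ → ℝ} (hp : ∀ u, 0 < p u)
    (hq : ∀ u, 0 < q u) (hpd : Differentiable ℝ p) (hqd : Differentiable ℝ q)
    (h : InterventionalDiscrepancy p q) :
    ∀ᵐ u : ℝ, deriv (fun v => Real.log (p v) - Real.log (q v)) u ≠ 0 := by
  filter_upwards [h] with u hu h0
  refine hu ?_
  have hd : DifferentiableAt ℝ (fun v => Real.log (p v) - Real.log (q v)) u :=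
    ((hpd u).log (hp u).ne').sub ((hqd u).log (hq u).ne')
  have he : (fun v => p v / q v) = fun v => Real.exp (Real.log (p v) - Real.log (q v)) := by
    funext v
    rw [Real.exp_sub, Real.exp_log (hp v), Real.exp_log (hq v)]
  rw [he, hd.hasDerivAt.exp.deriv, h0, mul_zero]

end Calculus

/-! ### Acyclic graphs -/

theorem IsDAG.wellFounded {V : Type*} [Finite V] {G : Digraph V} (hG : IsDAG G) :
    WellFounded G.Adj := by
  have : Std.Irrefl (Relation.TransGen G.Adj) := ⟨hG⟩
  exact Subrelation.wf (fun h => Relation.TransGen.single h)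
    (Finite.wellFounded_of_trans_of_irrefl (Relation.TransGen G.Adj))

theorem IsDAG.ne_of_adj {V : Type*} {G : Digraph V} (hG : IsDAG G) {a b : V} (h : G.Adj a b) :
    a ≠ b := by
  rintro rfl
  exact hG a (.single h)

theorem IsDAG.not_adj_of_adj {V : Type*} {G : Digraph V} (hG : IsDAG G) {a b : V}
    (h : G.Adj a b) : ¬ G.Adj b a :=
  fun h' => hG a (.tail (.single h) h')

/-! ### Log-ratios of the mechanisms and zero patterns of the score change matrices -/

namespace Model

variable {n d : ℕ} (M : Model n d)

theorem contDiff_pdf : ContDiff ℝ 1 M.pdf := contDiff_prod fun i _ => M.p_contDiff i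

theorem pdf_pos (z : Fin n → ℝ) : 0 < M.pdf z := Finset.prod_pos fun i _ => M.p_pos i z

theorem contDiff_hardPdf (l : Fin n) {r : ℝ → ℝ} (hr : IsC1Pdf r) :
    ContDiff ℝ 1 (M.hardPdf l r) :=
  (hr.contDiff.comp (contDiff_apply ℝ ℝ l)).mul (contDiff_prod fun i _ => M.p_contDiff i)

theorem hardPdf_pos (l : Fin n) {r : ℝ → ℝ} (hr : IsC1Pdf r) (z : Fin n → ℝ) :
    0 < M.hardPdf l r z :=
  mul_pos (hr.pos _) (Finset.prod_pos fun i _ => M.p_pos i z)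

/-- The logarithm of the ratio of the observational mechanism of node `l` and `r`. -/
noncomputable def logRatio (l : Fin n) (r : ℝ → ℝ) (z : Fin n → ℝ) : ℝ :=
  Real.log (M.p l z) - Real.log (r (z l))

theorem log_pdf_sub_log_hardPdf (l : Fin n) {r : ℝ → ℝ} (hr : IsC1Pdf r) (z : Fin n → ℝ) :
    Real.log (M.pdf z) - Real.log (M.hardPdf l r z) = M.logRatio l r z := by
  have hpos : 0 < ∏ i ∈ Finset.univ.erase l, M.p i z := Finset.prod_pos fun i _ => M.p_pos i z
  rw [pdf, hardPdf, ← Finset.mul_prod_erase _ _ (Finset.mem_univ l),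
    Real.log_mul (M.p_pos l z).ne' hpos.ne', Real.log_mul (hr.pos _).ne' hpos.ne', logRatio]
  ring

theorem log_hardPdf_sub_log_hardPdf (l : Fin n) {r s : ℝ → ℝ} (hr : IsC1Pdf r) (hs : IsC1Pdf s)
    (z : Fin n → ℝ) :
    Real.log (M.hardPdf l r z) - Real.log (M.hardPdf l s z) =
      Real.log (r (z l)) - Real.log (s (z l)) := by
  have hpos : 0 < ∏ i ∈ Finset.univ.erase l, M.p i z := Finset.prod_pos fun i _ => M.p_pos i z
  rw [hardPdf, hardPdf, Real.log_mul (hr.pos _).ne' hpos.ne',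
    Real.log_mul (hs.pos _).ne' hpos.ne']
  ring

theorem contDiff_logRatio (l : Fin n) {r : ℝ → ℝ} (hr : IsC1Pdf r) :
    ContDiff ℝ 1 (M.logRatio l r) :=
  ((M.p_contDiff l).log fun z => (M.p_pos l z).ne').sub
    ((hr.contDiff.comp (contDiff_apply ℝ ℝ l)).log fun _ => (hr.pos _).ne')

theorem logRatio_congr (l : Fin n) (r : ℝ → ℝ) {z z' : Fin n → ℝ} (hl : z l = z' l)
    (h : ∀ j, M.G.Adj j l → z j = z' j) : M.logRatio l r z = M.logRatio l r z' := by
  rw [logRatio, logRatio, M.p_local l z z' hl h, hl]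

theorem fderiv_logRatio_eq_zero (l : Fin n) {r : ℝ → ℝ} (hr : IsC1Pdf r) (z : Fin n → ℝ)
    {v : Fin n → ℝ} (hl : v l = 0) (hv : ∀ j, M.G.Adj j l → v j = 0) :
    fderiv ℝ (M.logRatio l r) z v = 0 :=
  fderiv_apply_eq_zero_of_forall_add_smul
    ((M.contDiff_logRatio l hr).differentiable one_ne_zero z) fun t =>
      M.logRatio_congr l r (by simp [hl]) fun j hj => by simp [hv j hj]

/-- Along a vector that does not move the parents of `l`, only the `l`-th partial derivative
contributes. -/
theorem fderiv_logRatio_of_parents (l : Fin n) {r : ℝ → ℝ} (hr : IsC1Pdf r) (z : Fin n → ℝ)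
    {v : Fin n → ℝ} (hv : ∀ j, M.G.Adj j l → v j = 0) :
    fderiv ℝ (M.logRatio l r) z v = v l * fderiv ℝ (M.logRatio l r) z (Pi.single l 1) := by
  -- Once its `l`-component is removed, `v` moves neither `l` nor a parent of `l`.
  have h := M.fderiv_logRatio_eq_zero l hr z (v := v - v l • Pi.single l 1) (by simp)
    fun j hj => by simp [hv j hj, M.isDAG.ne_of_adj hj]
  rw [map_sub, map_smul, smul_eq_mul, sub_eq_zero] at h
  exact h

theorem dense_fderiv_logRatio_ne_zero (l : Fin n) {r : ℝ → ℝ} (hr : IsC1Pdf r)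
    (hd : ∀ z, InterventionalDiscrepancy (fun u => M.p l (Function.update z l u)) r) :
    Dense {z | fderiv ℝ (M.logRatio l r) z (Pi.single l 1) ≠ 0} := by
  refine dense_of_forall_ae_update l fun z => ?_
  have hu : ∀ u, HasDerivAt (Function.update z l) (Pi.single l 1) u := hasDerivAt_update z l
  have hpd : Differentiable ℝ fun u => M.p l (Function.update z l u) := fun u =>
    ((M.p_contDiff l).differentiable one_ne_zero _).comp u (hu u).differentiableAt
  filter_upwards [(hd z).ae_deriv_log_ne_zero (fun u => M.p_pos l _) hr.pos hpd
    (hr.contDiff.differentiable one_ne_zero)] with u hne h0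
  refine hne ?_
  have h1 := ((M.contDiff_logRatio l hr).differentiable one_ne_zero
    (Function.update z l u)).hasFDerivAt.comp_hasDerivAt u (hu u)
  have h2 : M.logRatio l r ∘ Function.update z l =
      fun v => Real.log (M.p l (Function.update z l v)) - Real.log (r v) := by
    funext v
    simp [logRatio]
  rw [← h2, h1.deriv, h0]

/-- For `j = l` this is discrepancy. For a parent `j`, a vanishing partial derivative would make the
log-ratio constant in `z j`; as `r (z l)` does not change, neither would `p l`, against `p_parent`.
-/
theorem exists_fderiv_logRatio_ne_zero_iff (l j : Fin n) {r : ℝ → ℝ} (hr : IsC1Pdf r)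
    (hd : ∀ z, InterventionalDiscrepancy (fun u => M.p l (Function.update z l u)) r) :
    (∃ z, fderiv ℝ (M.logRatio l r) z (Pi.single j 1) ≠ 0) ↔ j = l ∨ M.G.Adj j l := by
  constructor
  · rintro ⟨z, hz⟩
    by_contra! hj
    refine hz (M.fderiv_logRatio_eq_zero l hr z (by simp [hj.1.symm]) fun i hi => ?_)
    rw [Pi.single_eq_of_ne]
    rintro rfl
    exact hj.2 hi
  · rintro (rfl | hj)
    · exact (M.dense_fderiv_logRatio_ne_zero j hr hd).nonempty
    · by_contra! h0
      obtain ⟨z, t, hzt⟩ := M.p_parent l j hj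
      have hjl := M.isDAG.ne_of_adj hj
      refine hzt ?_
      have hs : Function.update z j t - z = (t - z j) • Pi.single j 1 := by
        funext i
        by_cases hi : i = j
        · subst hi; simp
        · simp [hi]
      have he := eq_of_fderiv_sub_eq_zero ((M.contDiff_logRatio l hr).differentiable one_ne_zero) z
        (Function.update z j t) fun y => by rw [hs, map_smul, h0 y, smul_zero]
      rw [logRatio, logRatio, Function.update_of_ne hjl.symm, sub_left_inj] at he
      exact Real.log_injOn_pos (M.p_pos l _) (M.p_pos l _) he

theorem measurableSet_range_g : MeasurableSet (Set.range M.g) :=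
  (M.g_diffeo.1.continuous.measurableEmbedding M.g_diffeo.2.1.injective).measurableSet_range

/-- An encoder is arbitrary off the image of `g`, so it is only almost everywhere measurable; this
suffices because the law of `X` lives on that image. -/
theorem map_lawX {h : (Fin d → ℝ) → (Fin n → ℝ)} (hh : ContinuousOn h (Set.range M.g))
    (r : (Fin n → ℝ) → ℝ) :
    (M.lawX r).map h = (volume.withDensity fun z => ENNReal.ofReal (r z)).map (h ∘ M.g) := by
  have hg : Measurable M.g := M.g_diffeo.1.continuous.measurable
  have hae : AEMeasurable h (M.lawX r) := by
    have h1 := hh.aemeasurable (μ := M.lawX r) M.measurableSet_range_g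
    rwa [Measure.restrict_eq_self_of_ae_mem] at h1
    exact (ae_map_iff hg.aemeasurable M.measurableSet_range_g).2 (.of_forall fun z => ⟨z, rfl⟩)
  exact AEMeasurable.map_map_of_aemeasurable hae hg.aemeasurable

theorem lintegral_scoreDiff_ne_zero_iff {h : (Fin d → ℝ) → (Fin n → ℝ)}
    (hh : ValidEncoder (Set.range M.g) h) {r s : (Fin n → ℝ) → ℝ} (hr : ContDiff ℝ 1 r)
    (hrpos : ∀ z, 0 < r z) (hs : ContDiff ℝ 1 s) (hspos : ∀ z, 0 < s z) (i : Fin n) :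
    ∫⁻ w, ‖scoreDiff (h '' Set.range M.g) ((M.lawX r).map h) ((M.lawX s).map h) w i‖ₑ
        ∂((M.lawX M.pdf).map h) ≠ 0 ↔
      ∃ z, fderiv ℝ (fun y => Real.log (r y) - Real.log (s y)) z (frame (h ∘ M.g) i z) ≠ 0 := by
  rw [M.map_lawX hh.1.continuousOn, M.map_lawX hh.1.continuousOn, M.map_lawX hh.1.continuousOn,
    ← Set.range_comp]
  exact lintegral_scoreDiff_map_ne_zero_iff (hh.isC1OpenEmbedding M.g_diffeo)
    M.contDiff_pdf.continuous M.pdf_pos hr hrpos hs hspos i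

variable {h : (Fin d → ℝ) → (Fin n → ℝ)} (π : Equiv.Perm (Fin n))

theorem matD_ne_zero_iff (hh : ValidEncoder (Set.range M.g) h) (i m : Fin n) :
    M.data.matD h i m ≠ 0 ↔
      ∃ z, fderiv ℝ (M.logRatio (M.I m) (M.q (M.I m))) z (frame (h ∘ M.g) i z) ≠ 0 := by
  have hq := M.q_pdf (M.I m)
  have := M.lintegral_scoreDiff_ne_zero_iff hh M.contDiff_pdf M.pdf_pos
    (M.contDiff_hardPdf (M.I m) hq) (M.hardPdf_pos (M.I m) hq) i
  simp only [M.log_pdf_sub_log_hardPdf _ hq] at this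
  exact this

theorem matDtilde_relabel_ne_zero_iff (hh : ValidEncoder (Set.range M.g) h) (i m : Fin n) :
    (M.data.relabel π).matDtilde h i m ≠ 0 ↔
      ∃ z, fderiv ℝ (M.logRatio (M.It (π.symm m)) (M.qt (M.It (π.symm m)))) z
        (frame (h ∘ M.g) i z) ≠ 0 := by
  have hq := M.qt_pdf (M.It (π.symm m))
  have := M.lintegral_scoreDiff_ne_zero_iff hh M.contDiff_pdf M.pdf_pos
    (M.contDiff_hardPdf (M.It (π.symm m)) hq) (M.hardPdf_pos (M.It (π.symm m)) hq) i
  simp only [M.log_pdf_sub_log_hardPdf _ hq] at this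
  exact this

theorem matDt_relabel_ne_zero_iff (hh : ValidEncoder (Set.range M.g) h) (i m : Fin n)
    (hm : M.It (π.symm m) = M.I m) :
    (M.data.relabel π).matDt h i m ≠ 0 ↔
      ∃ z, deriv (fun u => Real.log (M.q (M.I m) u) - Real.log (M.qt (M.I m) u)) (z (M.I m)) *
        frame (h ∘ M.g) i z (M.I m) ≠ 0 := by
  have hq := M.q_pdf (M.I m)
  have hqt := M.qt_pdf (M.I m)
  have := M.lintegral_scoreDiff_ne_zero_iff hh (M.contDiff_hardPdf (M.I m) hq)
    (M.hardPdf_pos (M.I m) hq) (M.contDiff_hardPdf (M.I m) hqt) (M.hardPdf_pos (M.I m) hqt) i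
  have hdiff : Differentiable ℝ
      fun u => Real.log (M.q (M.I m) u) - Real.log (M.qt (M.I m) u) :=
    ((hq.contDiff.differentiable one_ne_zero).log fun u => (hq.pos u).ne').sub
      ((hqt.contDiff.differentiable one_ne_zero).log fun u => (hqt.pos u).ne')
  simp only [M.log_hardPdf_sub_log_hardPdf _ hq hqt, fderiv_comp_apply hdiff] at this
  rw [← this]
  simp only [ObservedData.matDt, ObservedData.scoreChange, ObservedData.relabel, Matrix.of_apply,
    data, hm]

end Model

/-! ### The constraints as zero patterns, and coordinatewise maps -/

theorem ObservedData.matD_relabel {n d : ℕ} (D : ObservedData n d) (π : Equiv.Perm (Fin n))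
    (h : (Fin d → ℝ) → (Fin n → ℝ)) : (D.relabel π).matD h = D.matD h := rfl

theorem indic_eq_indic_iff {n : ℕ} {A B : Matrix (Fin n) (Fin n) ℝ≥0∞} :
    indic A = indic B ↔ ∀ i j, A i j ≠ 0 ↔ B i j ≠ 0 := by
  simp only [← Matrix.ext_iff, indic, Matrix.of_apply]
  refine forall_congr' fun i => forall_congr' fun j => ?_
  by_cases hA : A i j = 0 <;> by_cases hB : B i j = 0 <;> simp [hA, hB]

theorem hadamard_indic_transpose_eq_one_iff {n : ℕ} {A : Matrix (Fin n) (Fin n) ℝ≥0∞} :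
    Matrix.hadamard (indic A) (indic A).transpose = 1 ↔
      (∀ i, A i i ≠ 0) ∧ ∀ i j, i ≠ j → A i j ≠ 0 → A j i = 0 := by
  simp only [← Matrix.ext_iff, indic, Matrix.of_apply, Matrix.hadamard_apply,
    Matrix.transpose_apply, Matrix.one_apply]
  constructor
  · refine fun h => ⟨fun i hi => ?_, fun i j hij hA => ?_⟩
    · simpa [hi] using h i i
    · simpa [hij, hA] using h i j
  · rintro ⟨h1, h2⟩ i j
    by_cases hij : i = j
    · subst hij
      simp [h1 i]
    · by_cases hA : A i j = 0
      · simp [hA, hij]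
      · simp [h2 i j hij hA, hij]

/-- A `C¹` open embedding for which, for every `m`, only the `m`-th vector of the frame has a
component in the direction `σ m`, acts coordinatewise up to the permutation `σ`. -/
theorem IsC1OpenEmbedding.perfectLatentRecovery {n : ℕ} {f : (Fin n → ℝ) → (Fin n → ℝ)}
    (hf : IsC1OpenEmbedding f) (σ : Equiv.Perm (Fin n))
    (h : ∀ m i z, i ≠ m → frame f i z (σ m) = 0) : PerfectLatentRecovery f := by
  -- Take the `σ m`-component of the expansion of `v` in the frame: only the `m`-th term survives.
  -- So the `m`-th coordinate of `f` is constant in all directions with zero `σ m`-component.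
  have key : ∀ z v m, fderiv ℝ f z v m * frame f m z (σ m) = v (σ m) := fun z v m => by
    have h1 := congrFun (hf.sum_frame z v) (σ m)
    rw [Finset.sum_apply, Finset.sum_eq_single m] at h1
    · simpa using h1
    · intro i _ hi
      simp [h m i z hi]
    · simp
  have hne : ∀ z m, frame f m z (σ m) ≠ 0 := fun z m h0 => by
    simpa [h0] using key z (Pi.single (σ m) 1) m
  have hcoord : ∀ m, Differentiable ℝ fun z => f z m := fun m =>
    differentiable_pi.1 (hf.contDiff.differentiable one_ne_zero) m
  have hcoord_fderiv : ∀ m z v, fderiv ℝ (fun z => f z m) z v = fderiv ℝ f z v m :=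
    fun m z v => by
      rw [((hasFDerivAt_pi'.1 (hf.hasFDerivAt z)) m).fderiv]
      rfl
  set φ : Fin n → ℝ → ℝ := fun j u => f (Pi.single j u) (σ.symm j) with hφ
  have hfφ : ∀ z m, f z m = φ (σ m) (z (σ m)) := fun z m => by
    rw [hφ]
    simp only [Equiv.symm_apply_apply]
    refine eq_of_fderiv_sub_eq_zero (hcoord m) _ _ fun y => ?_
    rw [hcoord_fderiv]
    refine (mul_eq_zero.1 ((key y _ m).trans ?_)).resolve_right (hne y m)
    simp
  refine ⟨σ, φ, fun j => ?_, fun hs j u => ?_, fun z i => hfφ z i⟩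
  · have hline : ∀ u, HasDerivAt (fun u : ℝ => (Pi.single j u : Fin n → ℝ)) (Pi.single j 1) u :=
      fun u => hasDerivAt_single j u
    have hc : ContDiff ℝ 1 (φ j) :=
      (contDiff_pi.1 hf.contDiff (σ.symm j)).comp
        (ContinuousLinearMap.single ℝ (fun _ => ℝ) j).contDiff
    refine (isC1OpenEmbedding_of_deriv_ne_zero hc fun u h0 => ?_).isC1DiffeoOntoImage
    have h1 : HasDerivAt (φ j) _ u :=
      (hcoord (σ.symm j) (Pi.single j u)).hasFDerivAt.comp_hasDerivAt u (hline u)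
    rw [h1.deriv, hcoord_fderiv] at h0
    simpa [h0] using key (Pi.single j u) (Pi.single j 1) (σ.symm j)
  · obtain ⟨z, hz⟩ := hs fun _ => u
    refine ⟨z j, ?_⟩
    have := hfφ z (σ.symm j)
    rw [hz] at this
    simpa using this.symm

/-! ### Consequences of feasibility -/

namespace Model

variable {n d : ℕ} (M : Model n d) {h : (Fin d → ℝ) → (Fin n → ℝ)} {π : Equiv.Perm (Fin n)}

/-- If the `m`-th environments of both families intervene on the same node and the `m`-th column of
`D_t(h)` is diagonal, that node affects only the `m`-th latent estimate. -/
theorem frame_apply_eq_zero (hM : M.Discrepancy) (hP : P2Feasible (M.data.relabel π) h)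
    {m : Fin n} (hm : M.It (π.symm m) = M.I m) {i : Fin n} (hi : i ≠ m) (z : Fin n → ℝ) :
    frame (h ∘ M.g) i z (M.I m) = 0 := by
  have hv : ValidEncoder (Set.range M.g) h := hP.valid
  have hf := hv.isC1OpenEmbedding M.g_diffeo
  by_contra hz
  have hq := M.q_pdf (M.I m)
  have hqt := M.qt_pdf (M.I m)
  have hd : Dense {z : Fin n → ℝ |
      deriv (fun u => Real.log (M.q (M.I m) u) - Real.log (M.qt (M.I m) u)) (z (M.I m)) ≠ 0} := by
    refine dense_of_forall_ae_update (M.I m) fun z => ?_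
    simp only [Function.update_self]
    exact (hM (M.I m)).2.2.ae_deriv_log_ne_zero hq.pos hqt.pos
      (hq.contDiff.differentiable one_ne_zero) (hqt.contDiff.differentiable one_ne_zero)
  -- A nonzero frame component persists on an open set, which meets the dense set given by
  -- discrepancy.
  obtain ⟨y, hy1, hy2⟩ := exists_ne_zero_and_of_dense
    ((continuous_apply (M.I m)).comp (hf.continuous_frame i)) hd ⟨z, hz⟩
  exact (M.matDt_relabel_ne_zero_iff π hv i m hm).2 ⟨y, mul_ne_zero hy2 hy1⟩ (hP.diag hi)

theorem correctCoupling_of_feasible (hM : M.Discrepancy)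
    (hP : P2Feasible (M.data.relabel π) h) : M.CorrectCoupling π := by
  have hv : ValidEncoder (Set.range M.g) h := hP.valid
  have hf := hv.isC1OpenEmbedding M.g_diffeo
  have hsame := indic_eq_indic_iff.1 hP.same
  obtain ⟨hdiag, hanti⟩ := hadamard_indic_transpose_eq_one_iff.1 hP.no_two_cycle
  rw [ObservedData.matD_relabel] at hsame hdiag hanti
  -- Quantifying over nodes rather than labels allows induction from parents to children.
  have key : ∀ t m k, M.I m = t → M.It (π.symm k) = t → m = k := by
    intro t
    induction t using M.isDAG.wellFounded.induction with
    | _ t ih =>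
    intro m k hm hk
    have hpar : ∀ i, i = m ∨ i = k → ∀ z l, M.G.Adj l t → frame (h ∘ M.g) i z l = 0 := by
      intro i hi z l hl
      have hlt := M.isDAG.ne_of_adj hl
      have hcor : M.It (π.symm (M.I.symm l)) = M.I (M.I.symm l) := by
        have e := ih l hl (M.I.symm l) (π (M.It.symm l)) (by simp) (by simp)
        rw [Equiv.apply_symm_apply, e]
        simp
      -- Otherwise the environment that hits `t` would also hit its parent `l`: in the first family
      -- if `i = m`, in the relabelled second one if `i = k`.
      have hil : i ≠ M.I.symm l := by
        rintro rfl
        rcases hi with hi | hi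
        · rw [← hi, Equiv.apply_symm_apply] at hm
          exact hlt hm
        · rw [← hi, hcor, Equiv.apply_symm_apply] at hk
          exact hlt hk
      simpa using M.frame_apply_eq_zero hM hP hcor hil z
    -- With the parents fixed, the derivative factors as the `t`-component of the frame times a
    -- densely nonzero function. The pattern is thus independent of `r`, which makes `q` and `q̃`
    -- comparable.
    have hpattern : ∀ i, i = m ∨ i = k → ∀ r, IsC1Pdf r →
        (∀ z, InterventionalDiscrepancy (fun u => M.p t (Function.update z t u)) r) →
        ((∃ z, fderiv ℝ (M.logRatio t r) z (frame (h ∘ M.g) i z) ≠ 0) ↔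
          ∃ z, frame (h ∘ M.g) i z t ≠ 0) := by
      intro i hi r hr hrd
      simp only [M.fderiv_logRatio_of_parents t hr _ (hpar i hi _), mul_ne_zero_iff]
      exact ⟨fun ⟨z, hz⟩ => ⟨z, hz.1⟩, exists_ne_zero_and_of_dense
        ((continuous_apply t).comp (hf.continuous_frame i))
        (M.dense_fderiv_logRatio_ne_zero t hr hrd)⟩
    have hD : ∀ i, i = m ∨ i = k →
        (M.data.matD h i m ≠ 0 ↔ ∃ z, frame (h ∘ M.g) i z t ≠ 0) := fun i hi => by
      rw [M.matD_ne_zero_iff hv, hm]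
      exact hpattern i hi _ (M.q_pdf t) (hM t).1
    have hDt : ∀ i, i = m ∨ i = k →
        (M.data.matD h i k ≠ 0 ↔ ∃ z, frame (h ∘ M.g) i z t ≠ 0) := fun i hi => by
      rw [hsame, M.matDtilde_relabel_ne_zero_iff π hv, hk]
      exact hpattern i hi _ (M.qt_pdf t) (hM t).2.1
    by_contra hmk
    have h1 := (hDt m (.inl rfl)).2 ((hD m (.inl rfl)).1 (hdiag m))
    have h2 := (hD k (.inr rfl)).2 ((hDt k (.inr rfl)).1 (hdiag k))
    exact h2 (hanti m k hmk h1)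
  intro m
  have := key (M.It m) (M.I.symm (M.It m)) (π m) (by simp) (by simp)
  rw [← this, Equiv.apply_symm_apply]

theorem frame_apply_eq_zero_of_feasible (hM : M.Discrepancy)
    (hP : P2Feasible (M.data.relabel π) h) (m i : Fin n) (z : Fin n → ℝ) (hi : i ≠ m) :
    frame (h ∘ M.g) i z (M.I m) = 0 := by
  refine M.frame_apply_eq_zero hM hP ?_ hi z
  rw [← M.correctCoupling_of_feasible hM hP, Equiv.apply_symm_apply]

theorem perfectLatentRecovery_of_feasible (hM : M.Discrepancy)
    (hP : P2Feasible (M.data.relabel π) h) : PerfectLatentRecovery fun z => h (M.g z) :=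
  (ValidEncoder.isC1OpenEmbedding M.g_diffeo hP.valid).perfectLatentRecovery M.I
    (M.frame_apply_eq_zero_of_feasible hM hP)

/-- Frame vector `j` is a nowhere zero multiple of the axis `I j`, so `D` detects the dependence of
mechanism `I i` on `z (I j)`; the isomorphism is the inverse of `I`. -/
theorem perfectDAGRecovery_of_feasible (hM : M.Discrepancy)
    (hP : P2Feasible (M.data.relabel π) h) : PerfectDAGRecovery M.G (graphOf M.data h) := by
  have hv : ValidEncoder (Set.range M.g) h := hP.valid
  have hf := hv.isC1OpenEmbedding M.g_diffeo
  have hframe : ∀ j z, frame (h ∘ M.g) j z =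
      frame (h ∘ M.g) j z (M.I j) • Pi.single (M.I j) 1 := fun j z => by
    funext l
    obtain ⟨m, rfl⟩ := M.I.surjective l
    by_cases hjm : m = j
    · subst hjm; simp
    · rw [M.frame_apply_eq_zero_of_feasible hM hP m j z (Ne.symm hjm)]
      simp [hjm]
  have hne : ∀ j z, frame (h ∘ M.g) j z (M.I j) ≠ 0 := fun j z h0 => by
    have h1 : frame (h ∘ M.g) j z = 0 := by rw [hframe, h0, zero_smul]
    have h2 := (hf.invertible z).self_apply_inverse (Pi.single j 1)
    rw [← frame, h1, map_zero] at h2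
    simpa using congrFun h2 j
  have hadj : ∀ j i, (graphOf M.data h).Adj j i ↔ M.G.Adj (M.I j) (M.I i) := fun j i => by
    have hD : M.data.matD h j i ≠ 0 ↔ M.I j = M.I i ∨ M.G.Adj (M.I j) (M.I i) := by
      rw [M.matD_ne_zero_iff hv, ← M.exists_fderiv_logRatio_ne_zero_iff (M.I i) (M.I j)
        (M.q_pdf (M.I i)) (hM (M.I i)).1]
      refine exists_congr fun z => ?_
      rw [hframe, map_smul, smul_eq_mul, mul_ne_zero_iff]
      exact and_iff_right (hne j z)
    change j ≠ i ∧ M.data.matD h j i ≠ 0 ↔ _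
    rw [hD, M.I.injective.eq_iff]
    refine ⟨fun hji => hji.2.resolve_left hji.1, fun hji => ⟨?_, .inr hji⟩⟩
    rintro rfl
    exact M.isDAG.ne_of_adj hji rfl
  exact ⟨⟨M.I.symm, fun {a b} => by rw [hadj, Equiv.apply_symm_apply, Equiv.apply_symm_apply]⟩⟩

/-! ### The true encoder is feasible -/

/-- The encoder that inverts the transform and lists the latent variables in the order of
intervention. -/
noncomputable def trueEncoder (x : Fin d → ℝ) (m : Fin n) : ℝ := Function.invFun M.g x (M.I m)

theorem trueEncoder_g (z : Fin n → ℝ) (m : Fin n) : M.trueEncoder (M.g z) m = z (M.I m) := by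
  rw [trueEncoder, Function.leftInverse_invFun M.g_diffeo.2.1.injective z]

theorem trueEncoder_surjective : Function.Surjective fun z => M.trueEncoder (M.g z) := fun w =>
  ⟨fun l => w (M.I.symm l), by
    funext m
    simp [trueEncoder_g]⟩

theorem validEncoder_trueEncoder : ValidEncoder (Set.range M.g) M.trueEncoder := by
  refine ⟨contDiffOn_pi.2 fun m => (contDiff_apply ℝ ℝ (M.I m)).comp_contDiffOn
    M.g_diffeo.contDiffOn_invFun, fun w => M.g fun l => w (M.I.symm l), ?_, ?_⟩
  · exact (M.g_diffeo.1.comp (contDiff_pi.2 fun l => contDiff_apply ℝ ℝ (M.I.symm l))).contDiffOn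
  · rintro _ ⟨z, rfl⟩
    simp [trueEncoder_g]

theorem frame_trueEncoder (i : Fin n) (z : Fin n → ℝ) :
    frame (M.trueEncoder ∘ M.g) i z = Pi.single (M.I i) 1 := by
  have hf := M.validEncoder_trueEncoder.isC1OpenEmbedding M.g_diffeo
  rw [frame, (hf.invertible z).inverse_apply_eq]
  have he : M.trueEncoder ∘ M.g =
      ContinuousLinearMap.pi fun m => ContinuousLinearMap.proj (R := ℝ) (M.I m) := by
    funext y m
    simp [trueEncoder_g]
  rw [he, ContinuousLinearMap.fderiv]
  funext m
  by_cases him : m = i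
  · subst him; simp
  · simp [him]

/-- The frame consists of coordinate axes, so `D` and `D̃` both have the pattern of the graph with
loops added; acyclicity excludes two-cycles. -/
theorem feasible_trueEncoder (hM : M.Discrepancy) (hπ : M.CorrectCoupling π) :
    P2Feasible (M.data.relabel π) M.trueEncoder := by
  have hv := M.validEncoder_trueEncoder
  have hcor : ∀ m, M.It (π.symm m) = M.I m := fun m => by
    rw [← hπ, Equiv.apply_symm_apply]
  have hD : ∀ i m, M.data.matD M.trueEncoder i m ≠ 0 ↔ M.I i = M.I m ∨ M.G.Adj (M.I i) (M.I m) :=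
    fun i m => by
      rw [M.matD_ne_zero_iff hv]
      simp only [frame_trueEncoder]
      exact M.exists_fderiv_logRatio_ne_zero_iff _ _ (M.q_pdf _) (hM _).1
  rw [← ObservedData.matD_relabel M.data π] at hD
  refine ⟨hv, fun i m him => ?_, indic_eq_indic_iff.2 fun i m => ?_,
    hadamard_indic_transpose_eq_one_iff.2 ⟨fun i => (hD i i).2 (.inl rfl), fun i j hij h1 => ?_⟩⟩
  · by_contra h0
    obtain ⟨z, hz⟩ := (M.matDt_relabel_ne_zero_iff π hv i m (hcor m)).1 h0
    refine hz ?_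
    rw [frame_trueEncoder, Pi.single_eq_of_ne (M.I.injective.ne him.symm), mul_zero]
  · refine (hD i m).trans ?_
    rw [M.matDtilde_relabel_ne_zero_iff π hv, hcor]
    simp only [frame_trueEncoder]
    exact (M.exists_fderiv_logRatio_ne_zero_iff _ _ (M.qt_pdf _) (hM _).2.1).symm
  · by_contra h0
    have h2 := ((hD i j).1 h1).resolve_left (M.I.injective.ne hij)
    have h3 := ((hD j i).1 h0).resolve_left (M.I.injective.ne hij.symm)
    exact M.isDAG.not_adj_of_adj h2 h3

theorem correctCoupling_symm_mul : M.CorrectCoupling (M.I⁻¹ * M.It) := fun m => by simp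

end Model

/-! ### Existence of solutions and the estimator -/

theorem P2Feasible.exists_solution {n d : ℕ} {D : ObservedData n d}
    {h : (Fin d → ℝ) → (Fin n → ℝ)} (hP : P2Feasible D h) : ∃ h', P2Solution D h' := by
  obtain ⟨h', hh', hmin⟩ := exists_minimalFor_of_wellFoundedLT (P2Feasible D)
    (fun h => l0norm (D.matDt h)) ⟨h, hP⟩
  exact ⟨h', hh', fun k hk => (le_total _ _).elim id (hmin hk)⟩

open Classical in
/-- An estimator that selects, if possible, a feasible encoder with image `ℝⁿ`. -/
noncomputable def estimator {n d : ℕ} (D : ObservedData n d) : (Fin d → ℝ) → (Fin n → ℝ) :=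
  if H : ∃ h, (∃ π, P2Feasible (D.relabel π) h) ∧ h '' D.X = Set.univ then H.choose else 0

theorem estimator_spec {n d : ℕ} {D : ObservedData n d}
    (H : ∃ h, (∃ π, P2Feasible (D.relabel π) h) ∧ h '' D.X = Set.univ) :
    (∃ π, P2Feasible (D.relabel π) (estimator D)) ∧ estimator D '' D.X = Set.univ := by
  rw [estimator, dif_pos H]
  exact H.choose_spec

/-- The true encoder shows that the selection is possible. Asking for the full image `ℝⁿ` is what
makes the `φ_i` onto the line. -/
theorem Model.estimator_data_spec {n d : ℕ} (M : Model n d) (hM : M.Discrepancy) :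
    (∃ π, P2Feasible (M.data.relabel π) (estimator M.data)) ∧
      Function.Surjective fun z => estimator M.data (M.g z) := by
  have H := estimator_spec (D := M.data) ⟨M.trueEncoder,
    ⟨_, M.feasible_trueEncoder hM M.correctCoupling_symm_mul⟩,
    (Set.range_comp _ _).symm.trans M.trueEncoder_surjective.range_eq⟩
  exact ⟨H.1, Set.range_eq_univ.1 ((Set.range_comp _ _).trans H.2)⟩

end CRL

theorem theorem1 (n d : ℕ) :
    -- identifiability: estimators that use the observed data alone recover every model
    (∃ (Zhat : CRL.ObservedData n d → (Fin d → ℝ) → (Fin n → ℝ))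
        (Ghat : CRL.ObservedData n d → Digraph (Fin n)),
      ∀ M : CRL.Model n d, M.Discrepancy →
        CRL.PerfectDAGRecovery M.G (Ghat M.data) ∧
        CRL.PerfectLatentRecovery (fun z => Zhat M.data (M.g z)) ∧
        Function.Surjective (fun z => Zhat M.data (M.g z))) ∧
    ∀ M : CRL.Model n d, M.Discrepancy →
      -- the problem `P₂` is feasible exactly for the correct coupling, and it then has a solution
      (∀ π : Equiv.Perm (Fin n),
        (∃ h, CRL.P2Feasible (M.data.relabel π) h) ↔ M.CorrectCoupling π) ∧
      (∀ π : Equiv.Perm (Fin n),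
        M.CorrectCoupling π → ∃ h, CRL.P2Solution (M.data.relabel π) h) ∧
      -- achievability: GSCALE-I returns an output, and every output is a perfect recovery
      (∃ h Gh, CRL.GSCALEI M.data h Gh) ∧
      (∀ h Gh, CRL.GSCALEI M.data h Gh →
        CRL.PerfectDAGRecovery M.G Gh ∧
        CRL.PerfectLatentRecovery (fun z => h (M.g z))) := by
  refine ⟨⟨CRL.estimator, fun D => CRL.graphOf D (CRL.estimator D), fun M hM => ?_⟩,
    fun M hM => ⟨fun π => ⟨fun ⟨_, hP⟩ => M.correctCoupling_of_feasible hM hP,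
      fun hπ => ⟨_, M.feasible_trueEncoder hM hπ⟩⟩,
      fun π hπ => (M.feasible_trueEncoder hM hπ).exists_solution, ?_, ?_⟩⟩
  · obtain ⟨⟨π, hP⟩, hs⟩ := M.estimator_data_spec hM
    exact ⟨M.perfectDAGRecovery_of_feasible hM hP, M.perfectLatentRecovery_of_feasible hM hP, hs⟩
  · obtain ⟨h, hh⟩ := (M.feasible_trueEncoder hM M.correctCoupling_symm_mul).exists_solution
    exact ⟨h, _, ⟨_, hh⟩, rfl⟩
  -- The graph is read from `D`, which relabelling the second family leaves unchanged.
  · rintro h _ ⟨⟨π, hP⟩, rfl⟩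
    exact ⟨M.perfectDAGRecovery_of_feasible hM hP.1, M.perfectLatentRecovery_of_feasible hM hP.1⟩
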